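/- Let $\mathbb K$ be a (commutative) field and let $U$, $V$ be finite-dimensional vector spaces over $\mathbb K$. Let $n\ge 3$ be an integer with $\#\mathbb K>n$, and let $\mathcal T$ be an $n$-dimensional linear subspace of the space $\mathcal L(U,V)$ of linear operators from $U$ to $V$. Assume that: - $\mathcal T$ is reduced, i.e. $\bigcap_{f\in\mathcal T}\ker f=\{0\}$ and $\sum_{f\in\mathcal T}\operatorname{im} f=V$; - $\mathcal T$ is not (algebraically) reflexive, i.e. there is an operator $g\in\mathcal L(U,V)\setminus\mathcal T$ such that $g(x)\in\{f(x)\mid f\in\mathcal T\}$ for every $x\in U$; - every non-zero operator in $\mathcal T$ has rank at least $2n-2$. Then there is an $(n-1)$-dimensional LDB division algebra $(A,\star,\bullet)$ over $\mathbb K$ such that $\mathcal T$ is equivalent to a linear hyperplane of the twisted operator space $\mathcal T_{A,\star,\bullet}$. Here an LDB (left-division-bilinearizable) division algebra over $\mathbb K$ is a triple $(A,\star,\bullet)$ in which $A$ is a $\mathbb K$-vector space of finite positive dimension and $\star,\bullet:A\times A\to A$ are bilinear maps such that $a\star b\ne 0$ whenever $a\neq 0$ and $b\ne 0$; $x\bullet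 y=0$ if and only if $x=0$ or $y=0$; and the vectors $x\star(x\bullet y)$ and $y$ are linearly dependent for all $(x,y)\in A^2$. Its twisted operator space $\mathcal T_{A,\star,\bullet}$ is the space of all endomorphisms of $A^2$ of the form $(y,z)\mapsto(x\star z+\lambda y,\;x\bullet y+\mu z)$ with $(x,\lambda,\mu)\in A\times\mathbb K^2$. A linear hyperplane is a linear subspace of codimension $1$. Two operator spaces $\mathcal S\subset\mathcal L(U,V)$ and $\mathcal S'\subset\mathcal L(U',V')$ are equivalent when there are linear isomorphisms $F:U\to U'$ and $G:V'\to V$ with $\mathcal S=\{G\circ g\circ F\mid g\in\mathcal S'\}$. -/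

import Mathlib

universe u v w v' w'

namespace OperatorSpace

section Operators

variable {K : Type u} [Field K]
variable {U : Type v} [AddCommGroup U] [Module K U] {V : Type w} [AddCommGroup V] [Module K V]
variable {U' : Type v'} [AddCommGroup U'] [Module K U']
variable {V' : Type w'} [AddCommGroup V'] [Module K V']

/-- The kernel of an operator space: the vectors at which all its operators vanish. -/
def kernel (S : Submodule K (U →ₗ[K] V)) : Submodule K U :=
  ⨅ f ∈ S, LinearMap.ker f

/-- The essential range of an operator space: the sum of the ranges of its operators. -/
def essentialRange (S : Submodule K (U →ₗ[K] V)) : Submodule K V :=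
  ⨆ f ∈ S, LinearMap.range f

/-- An operator space is reduced when its kernel is zero and its essential range is the whole
target space. -/
def IsReduced (S : Submodule K (U →ₗ[K] V)) : Prop :=
  kernel S = ⊥ ∧ essentialRange S = ⊤

/-- The reflexive closure of `S`: the operators `g` such that `g x` lies in
`S x = {f x | f ∈ S}` for every vector `x`. -/
def reflexiveClosure (S : Submodule K (U →ₗ[K] V)) : Submodule K (U →ₗ[K] V) where
  carrier := {g | ∀ x : U, ∃ f ∈ S, f x = g x}
  zero_mem' := fun x => ⟨0, S.zero_mem, rfl⟩
  add_mem' := by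
    intro g h hg hh x
    obtain ⟨f₁, hf₁, e₁⟩ := hg x
    obtain ⟨f₂, hf₂, e₂⟩ := hh x
    exact ⟨f₁ + f₂, S.add_mem hf₁ hf₂, by simp [e₁, e₂]⟩
  smul_mem' := by
    intro c g hg x
    obtain ⟨f, hf, e⟩ := hg x
    exact ⟨c • f, S.smul_mem c hf, by simp [e]⟩

/-- An operator space is (algebraically) reflexive when it equals its reflexive closure. -/
def IsReflexive (S : Submodule K (U →ₗ[K] V)) : Prop :=
  S = reflexiveClosure S

/-- Equivalence of operator spaces: `S = {G ∘ g ∘ F | g ∈ S'}` for some linear isomorphisms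
`F : U ≃ U'` and `G : V' ≃ V`. -/
def Equivalent (S : Submodule K (U →ₗ[K] V)) (S' : Submodule K (U' →ₗ[K] V')) : Prop :=
  ∃ (F : U ≃ₗ[K] U') (G : V' ≃ₗ[K] V), ∀ f : U →ₗ[K] V,
    f ∈ S ↔ ∃ g ∈ S', f = G.toLinearMap ∘ₗ g ∘ₗ F.toLinearMap

/-- `H` is a (linear) hyperplane of `S`: a linear subspace of `S` of codimension one in `S`. -/
def IsHyperplaneOf (H S : Submodule K (U →ₗ[K] V)) : Prop :=
  H ≤ S ∧ Module.finrank K (S ⧸ H.submoduleOf S) = 1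

end Operators

section LDB

variable {K : Type u} [Field K] {A : Type v} [AddCommGroup A] [Module K A]

/-- A bilinear map `A × A → A` is regular when the product of two non-zero vectors is non-zero. -/
def IsRegular (star : A →ₗ[K] A →ₗ[K] A) : Prop :=
  ∀ a b : A, a ≠ 0 → b ≠ 0 → star a b ≠ 0

/-- A quasi-left-inversion of `star`: a binary operation `bullet` on `A` which vanishes exactly on
`(A × {0}) ∪ ({0} × A)`, and such that `star x (bullet x y)` and `y` are collinear
(that is, linearly dependent) for all `x` and `y`. -/
def IsQuasiLeftInversion (star : A →ₗ[K] A →ₗ[K] A) (bullet : A → A → A) : Prop :=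
  (∀ x y : A, bullet x y = 0 ↔ x = 0 ∨ y = 0) ∧
    ∀ x y : A, ¬ LinearIndependent K ![star x (bullet x y), y]

/-- `(A, star, bullet)` is a left-division-bilinearizable (LDB) division algebra: `A` is a
finite-dimensional vector space of positive dimension, `star` is a regular bilinear map, and
`bullet` is a bilinear quasi-left-inversion of `star`. -/
structure IsLDBDivisionAlgebra (star bullet : A →ₗ[K] A →ₗ[K] A) : Prop where
  finiteDimensional : FiniteDimensional K A
  nontrivial : Nontrivial A
  regular : IsRegular star
  quasiLeftInversion : IsQuasiLeftInversion star (fun x y => bullet x y)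

/-- The bilinear map `(x + (s, t), (y, z)) ↦ (star x z + s y, bullet x y + t z)` from
`(A ⊕ K²) × A²` to `A²`, as a linear map from `A ⊕ K²` to the endomorphisms of `A²`. -/
def twistedMap (star bullet : A →ₗ[K] A →ₗ[K] A) :
    (A × K × K) →ₗ[K] (A × A) →ₗ[K] (A × A) :=
  LinearMap.mk₂ K
    (fun p q => (star p.1 q.2 + p.2.1 • q.1, bullet p.1 q.1 + p.2.2 • q.2))
    (by
      intro p p' q
      ext <;> simp [add_smul] <;> abel)
    (by
      intro c p q
      ext <;> simp [mul_smul])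
    (by
      intro p q q'
      ext <;> simp <;> abel)
    (by
      intro c p q
      ext <;> simp [smul_comm c])

/-- The twisted operator space attached to `(A, star, bullet)`: all the endomorphisms
`(y, z) ↦ (star x z + s y, bullet x y + t z)` of `A²`, for `x` in `A` and `s`, `t` in `K`. -/
def twistedOperatorSpace (star bullet : A →ₗ[K] A →ₗ[K] A) :
    Submodule K ((A × A) →ₗ[K] (A × A)) :=
  LinearMap.range (twistedMap star bullet)

end LDB

end OperatorSpace

/-! Write n for the dimension of `T` and take g in the reflexive closure, outside `T`. Each
separating vector x has a unique annihilator f ∈ g + T, f x = 0. A pencil argument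
(`apply_mem_range_of_chain`), applied to evaluation at x and at y on T × K, gives `chain_mem_orbit`:
f y ∈ T x; if t x = f y then t y ∈ T x; if also s x = t y then s y ∈ T x.

Polarising these relations and playing them against the rank bound 2n - 2 yields rank f < n
(`finrank_range_ne`). As g ∉ T, two separating vectors x, y have distinct annihilators f, h. Since f
- h is a non-zero operator of `T`, 2n - 2 ≤ rank f + rank h, so both ranks are n - 1 and the ranges
are independent. At this rank, every non-zero t ∈ T with t x ∈ range f maps ker f onto range f
(`map_ker_eq_range`).

Let Q consist of the operators of T ⊕ K f that send x into range f and y into range h. Counting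
dimensions, T ⊕ K f = Q ⊕ K f ⊕ K h, and reducedness gives U = ker h ⊕ ker f, V = range f ⊕ range h.
In these splittings f and h are the diagonal projections and Q is antidiagonal; its two blocks are
the products ⋆ and •, and the collinearity axiom expresses that f lies in the reflexive closure of
`T` (`exists_algebra_of_splitting`). -/

namespace OperatorSpace

open Module

/-! ### Pencils of operators with a member of maximal rank. -/

section Pencil

variable {K : Type u} [Field K] {V : Type w} [AddCommGroup V] [Module K V]

/-- In coordinates where x is the standard basis, the family becomes 1 + cW, whose determinant is a
polynomial in c with constant term 1 and, as det W = 0, degree below r. This leaves room for a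
factor X, forcing c ≠ 0, within the bound r < #K. -/
lemma exists_linearIndependent_add_smul {r : ℕ} (hK : (r : Cardinal.{u}) < Cardinal.mk K)
    {x y : Fin r → V} (hx : LinearIndependent K x) (hy : ¬ LinearIndependent K y) :
    ∃ c : K, c ≠ 0 ∧ LinearIndependent K (fun i => x i + c • y i) := by
  classical
  obtain ⟨φ, hφ⟩ := LinearMap.exists_leftInverse_of_injective (Fintype.linearCombination K x)
    (LinearMap.ker_eq_bot.2 hx.fintypeLinearCombination_injective)
  have hφx : ∀ i, φ (x i) = Pi.single i 1 := fun i => by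
    have := LinearMap.congr_fun hφ (Pi.single i 1)
    simpa [Fintype.linearCombination_apply_single] using this
  set W : Matrix (Fin r) (Fin r) K := Matrix.of fun i j => φ (y i) j with hW
  have hdetW : W.det = 0 := by
    by_contra h
    refine hy (LinearIndependent.of_comp φ ?_)
    exact Matrix.linearIndependent_rows_of_det_ne_zero h
  set p : Polynomial K :=
    ((Polynomial.X : Polynomial K) • W.map Polynomial.C
      + (1 : Matrix (Fin r) (Fin r) K).map Polynomial.C).det with hp
  have hp0 : p.coeff 0 = 1 := by
    rw [hp, Polynomial.coeff_det_X_add_C_zero, Matrix.det_one]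
  have hpr : p.coeff r = 0 := by
    have := Polynomial.coeff_det_X_add_C_card W 1
    rw [Fintype.card_fin] at this
    rw [hp, this, hdetW]
  have hdeg : p.natDegree ≤ r := by
    have := Polynomial.natDegree_det_X_add_C_le W 1
    rwa [Fintype.card_fin] at this
  have hpne : p ≠ 0 := by
    rintro h
    simp [h] at hp0
  have hlt : p.natDegree < r := by
    refine lt_of_le_of_ne hdeg fun h => hpne ?_
    rw [← h] at hpr
    exact Polynomial.leadingCoeff_eq_zero.1 hpr
  obtain ⟨c, hc⟩ := Polynomial.exists_eval_ne_zero_of_natDegree_lt_card (p * Polynomial.X)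
    (mul_ne_zero hpne Polynomial.X_ne_zero) (by
      rw [Polynomial.natDegree_mul_X hpne]
      exact lt_of_le_of_lt (by exact_mod_cast hlt) hK)
  rw [Polynomial.eval_mul, Polynomial.eval_X] at hc
  refine ⟨c, right_ne_zero_of_mul hc, LinearIndependent.of_comp φ ?_⟩
  have hdet : (c • W + 1).det ≠ 0 := by
    have := left_ne_zero_of_mul hc
    rw [hp, ← Polynomial.coe_evalRingHom, RingHom.map_det] at this
    convert this using 2
    ext i j
    by_cases h : i = j <;> simp [h, mul_comm c]
  have hrow := Matrix.linearIndependent_rows_of_det_ne_zero hdet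
  have heq : (⇑φ ∘ fun i => x i + c • y i) = fun i => (c • W + 1) i := by
    ext i j
    simp [hφx, hW, Matrix.one_apply, Pi.single_apply, add_comm, eq_comm]
  rw [heq]
  exact hrow

/-- A subspace containing a non-zero vector `q` and `r` vectors that are independent modulo `q`
has dimension greater than `r`. -/
lemma lt_finrank_of_linearIndependent_mkQ [FiniteDimensional K V] {r : ℕ} {R : Submodule K V}
    {q : V} (hq : q ≠ 0) (hqR : q ∈ R) {x : Fin r → V} (hx : ∀ i, x i ∈ R)
    (hli : LinearIndependent K (fun i => (K ∙ q).mkQ (x i))) : r < finrank K R := by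
  set ψ := (K ∙ q).mkQ.domRestrict R
  have h1 := LinearMap.finrank_range_add_finrank_ker ψ
  have h2 : r ≤ finrank K (LinearMap.range ψ) := by
    have : LinearIndependent K (fun i => (⟨ψ ⟨x i, hx i⟩, LinearMap.mem_range_self _ _⟩ :
        LinearMap.range ψ)) := by
      apply LinearIndependent.of_comp (LinearMap.range ψ).subtype
      exact hli
    simpa using this.fintype_card_le_finrank
  have h3 : 0 < finrank K (LinearMap.ker ψ) := by
    have : Nontrivial (LinearMap.ker ψ) :=
      ⟨⟨⟨⟨q, hqR⟩, by simp [ψ]⟩, 0, fun h => hq (by simpa using h)⟩⟩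
    exact finrank_pos
  omega

variable {S : Type v} [AddCommGroup S] [Module K S]

/-- If `M` has maximal rank `r` in the pencil spanned by `M` and `N`, then `N` maps every chain
`M s₀ = 0, M s₁ = N s₀, M s₂ = N s₁, …` into the range of `M`. -/
lemma apply_mem_range_of_chain [FiniteDimensional K V] (M N : S →ₗ[K] V)
    (hK : (finrank K (LinearMap.range M) : Cardinal.{u}) < Cardinal.mk K)
    (hN : finrank K (LinearMap.range N) ≤ finrank K (LinearMap.range M))
    (hMN : ∀ c : K, finrank K (LinearMap.range (M + c • N)) ≤ finrank K (LinearMap.range M))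
    (s : ℕ → S) (k : ℕ) (h0 : M (s 0) = 0) (hs : ∀ i < k, M (s (i + 1)) = N (s i)) :
    N (s k) ∈ LinearMap.range M := by
  by_contra hq
  set r := finrank K (LinearMap.range M) with hr
  have hq0 : N (s k) ≠ 0 := fun h => hq (h ▸ Submodule.zero_mem _)
  let b := finBasisOfFinrankEq K (LinearMap.range M) hr.symm
  choose e he using fun i => (b i).2
  have hx : LinearIndependent K (fun i => (K ∙ N (s k)).mkQ (M (e i))) := by
    have hb : LinearIndependent K (fun i => ((b i : LinearMap.range M) : V)) :=
      b.linearIndependent.map' (LinearMap.range M).subtype (Submodule.ker_subtype _)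
    simp only [he]
    refine hb.map (f := (K ∙ N (s k)).mkQ) ?_
    rw [Submodule.ker_mkQ, disjoint_comm]
    refine (Submodule.disjoint_span_singleton' hq0).2 ?_ |>.symm
    intro h
    refine hq (Submodule.span_le.2 ?_ h)
    rintro _ ⟨i, rfl⟩
    exact (b i).2
  -- The range of N contains q = N (s k) and has dimension at most r, so it loses a dimension modulo
  -- q.
  have hy : ¬ LinearIndependent K (fun i => (K ∙ N (s k)).mkQ (N (e i))) := fun h =>
    absurd (lt_finrank_of_linearIndependent_mkQ hq0 (LinearMap.mem_range_self N _)
      (fun i => LinearMap.mem_range_self N (e i)) h) (not_lt.2 hN)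
  obtain ⟨c, hc, hli⟩ := exists_linearIndependent_add_smul hK hx hy
  -- The geometric sum along the chain telescopes, so q lies in the range of M + cN as well, whose
  -- rank then exceeds r.
  have htel : ∀ j ≤ k, (M + c • N) (∑ i ∈ Finset.range (j + 1), (-c) ^ i • s i)
      = (c * (-c) ^ j) • N (s j) := by
    intro j
    induction j with
    | zero => intro _; simp [h0]
    | succ j ih =>
      intro hj
      rw [Finset.sum_range_succ, map_add, ih (by omega)]
      simp only [map_smul, LinearMap.add_apply, LinearMap.smul_apply, hs j (by omega)]
      module
  have hmem : N (s k) ∈ LinearMap.range (M + c • N) := by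
    have h1 : (c * (-c) ^ k) • N (s k) ∈ LinearMap.range (M + c • N) :=
      htel k le_rfl ▸ LinearMap.mem_range_self _ _
    exact (Submodule.smul_mem_iff _ (mul_ne_zero hc (pow_ne_zero _ (neg_ne_zero.2 hc)))).1 h1
  refine absurd (lt_finrank_of_linearIndependent_mkQ hq0 hmem
    (fun i => LinearMap.mem_range_self (M + c • N) (e i)) ?_) (not_lt.2 (hMN c))
  simpa using hli

end Pencil

/-! ### Separating vectors and the reflexive closure. -/

section Generic

variable {K : Type u} [Field K] {U : Type v} [AddCommGroup U] [Module K U]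
  {V : Type w} [AddCommGroup V] [Module K V]

/-- The subspace `{t x | t ∈ T}`. -/
def orbit (T : Submodule K (U →ₗ[K] V)) (x : U) : Submodule K V :=
  T.map (LinearMap.applyₗ x)

lemma mem_orbit {T : Submodule K (U →ₗ[K] V)} {x : U} {v : V} :
    v ∈ orbit T x ↔ ∃ t ∈ T, t x = v := by
  simp [orbit]

lemma apply_mem_orbit {T : Submodule K (U →ₗ[K] V)} {t : U →ₗ[K] V} (ht : t ∈ T) (x : U) :
    t x ∈ orbit T x :=
  mem_orbit.2 ⟨t, ht, rfl⟩

lemma le_reflexiveClosure (T : Submodule K (U →ₗ[K] V)) : T ≤ reflexiveClosure T :=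
  fun t ht _ => ⟨t, ht, rfl⟩

/-- A vector separates `T` when no non-zero operator of `T` vanishes at it. -/
def IsSeparatingVector (T : Submodule K (U →ₗ[K] V)) (x : U) : Prop :=
  ∀ t ∈ T, t x = 0 → t = 0

lemma IsSeparatingVector.eq {T : Submodule K (U →ₗ[K] V)} {x : U} (hx : IsSeparatingVector T x)
    {s t : U →ₗ[K] V} (hs : s ∈ T) (ht : t ∈ T) (h : s x = t x) : s = t :=
  sub_eq_zero.1 (hx _ (T.sub_mem hs ht) (by simp [h]))

lemma IsSeparatingVector.finrank_orbit {T : Submodule K (U →ₗ[K] V)} {x : U}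
    (hx : IsSeparatingVector T x) : finrank K (orbit T x) = finrank K T := by
  have h := LinearMap.finrank_range_of_inj (f := (LinearMap.applyₗ x).domRestrict T) (by
    intro s t h
    exact Subtype.ext (hx.eq s.2 t.2 h))
  rw [← h, LinearMap.range_domRestrict]
  rfl

lemma isSeparatingVector_iff_linearIndependent {T : Submodule K (U →ₗ[K] V)} {x : U} {r : ℕ}
    (b : Basis (Fin r) K T) :
    IsSeparatingVector T x ↔ LinearIndependent K (fun i => (b i : U →ₗ[K] V) x) := by
  constructor
  · intro hx
    refine b.linearIndependent.map' ((LinearMap.applyₗ x).domRestrict T) ?_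
    rw [LinearMap.ker_eq_bot']
    intro t ht
    exact Subtype.ext (hx t t.2 ht)
  · intro h t ht htx
    have hsum := b.sum_repr ⟨t, ht⟩
    have h0 : ∑ i, b.repr ⟨t, ht⟩ i • (b i : U →ₗ[K] V) x = 0 := by
      rw [← htx]
      have := congrArg ((LinearMap.applyₗ x).domRestrict T) hsum
      rw [map_sum] at this
      simpa only [map_smul, LinearMap.domRestrict_apply, LinearMap.applyₗ_apply_apply] using this
    have hz := Fintype.linearIndependent_iff.1 h _ h0
    have : (⟨t, ht⟩ : T) = 0 := by
      rw [← hsum]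
      exact Finset.sum_eq_zero fun i _ => by rw [hz i, zero_smul]
    simpa using this

variable [FiniteDimensional K V]

/-- If the orbit of `x` has maximal dimension, `f` is in the reflexive closure and `f x = 0`,
then all operators of a chain starting with `f` map `y` into the orbit of `x`. -/
lemma chain_mem_orbit {T : Submodule K (U →ₗ[K] V)} {x : U}
    (hK : (finrank K (orbit T x) : Cardinal.{u}) < Cardinal.mk K)
    (hmax : ∀ y, finrank K (orbit T y) ≤ finrank K (orbit T x))
    {f : U →ₗ[K] V} (hf : f ∈ reflexiveClosure T) (hfx : f x = 0) (y : U) :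
    f y ∈ orbit T x ∧
    (∀ t ∈ T, t x = f y → t y ∈ orbit T x) ∧
    (∀ t ∈ T, ∀ s ∈ T, t x = f y → s x = t y → s y ∈ orbit T x) := by
  -- Vectors act on operators. Adjoining f does not enlarge the range, f being in the reflexive
  -- closure, but puts (0, 1) into the kernel of `ev x`, where the chains start.
  let ev : U →ₗ[K] (T × K →ₗ[K] V) := LinearMap.mk₂ K
    (fun z p => (p.1 : U →ₗ[K] V) z + p.2 • f z)
    (by intros; simp only [map_add]; module) (by intros; simp only [map_smul]; module)
    (by intros; simp [add_smul]; abel) (by intros; simp [mul_smul])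
  have hev : ∀ z p, ev z p = (p.1 : U →ₗ[K] V) z + p.2 • f z := fun z p => rfl
  have hrange : ∀ z, LinearMap.range (ev z) = orbit T z := by
    intro z
    apply le_antisymm
    · rintro _ ⟨p, rfl⟩
      exact add_mem (apply_mem_orbit p.1.2 z) (Submodule.smul_mem _ _ (mem_orbit.2 (hf z)))
    · intro v hv
      obtain ⟨t, ht, rfl⟩ := mem_orbit.1 hv
      exact ⟨(⟨t, ht⟩, 0), by simp [hev]⟩
  have key := apply_mem_range_of_chain (ev x) (ev y) (by rwa [hrange])
    (by rw [hrange, hrange]; exact hmax y)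
    (fun c => by rw [← map_smul, ← map_add, hrange, hrange]; exact hmax _)
  rw [hrange] at key
  refine ⟨?_, ?_, ?_⟩
  · simpa [hev] using key (fun _ => (0, 1)) 0 (by simp [hev, hfx]) (by simp)
  · intro t ht h
    simpa [hev] using key (fun i => if i = 0 then (0, 1) else (⟨t, ht⟩, 0)) 1
      (by simp [hev, hfx]) (by
        intro i hi
        obtain rfl : i = 0 := by omega
        simp [hev, h])
  · intro t ht s hs h h'
    simpa [hev] using key
      (fun i => if i = 0 then (0, 1) else if i = 1 then (⟨t, ht⟩, 0) else (⟨s, hs⟩, 0)) 2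
      (by simp [hev, hfx]) (by
        intro i hi
        obtain rfl | rfl : i = 0 ∨ i = 1 := by omega
        · simp [hev, h]
        · simp [hev, h'])

variable [FiniteDimensional K U]

lemma finrank_orbit_le (T : Submodule K (U →ₗ[K] V)) (x : U) :
    finrank K (orbit T x) ≤ finrank K T :=
  Submodule.finrank_map_le _ _

lemma isSeparatingVector_of_finrank {T : Submodule K (U →ₗ[K] V)} {x : U}
    (hx : finrank K (orbit T x) = finrank K T) : IsSeparatingVector T x := by
  have h := LinearMap.finrank_range_add_finrank_ker ((LinearMap.applyₗ x).domRestrict T)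
  rw [LinearMap.range_domRestrict] at h
  have h2 : finrank K (LinearMap.ker ((LinearMap.applyₗ x).domRestrict T)) = 0 := by
    unfold orbit at hx
    omega
  intro t ht htx
  have : (⟨t, ht⟩ : T) ∈ LinearMap.ker ((LinearMap.applyₗ x).domRestrict T) := by
    simpa using htx
  rw [Submodule.finrank_eq_zero.1 h2] at this
  simpa using this

lemma exists_isSeparatingVector {T : Submodule K (U →ₗ[K] V)}
    (hK : (finrank K T : Cardinal.{u}) < Cardinal.mk K)
    (hrank : ∀ f ∈ T, f ≠ 0 → finrank K T ≤ finrank K (LinearMap.range f)) :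
    ∃ x, IsSeparatingVector T x := by
  obtain ⟨x, hx⟩ : ∃ x, ∀ y, finrank K (orbit T y) ≤ finrank K (orbit T x) := by
    refine ⟨Function.argmin (fun x => finrank K T - finrank K (orbit T x)), fun y => ?_⟩
    have h := Function.argmin_le (fun x => finrank K T - finrank K (orbit T x)) y
    have h1 := finrank_orbit_le T y
    have h2 := finrank_orbit_le T
      (Function.argmin (fun x => finrank K T - finrank K (orbit T x)))
    omega
  refine ⟨x, ?_⟩
  by_contra hsep
  have hlt : finrank K (orbit T x) < finrank K T :=
    lt_of_le_of_ne (finrank_orbit_le T x) fun h => hsep (isSeparatingVector_of_finrank h)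
  simp only [IsSeparatingVector, not_forall] at hsep
  obtain ⟨t, ht, htx, ht0⟩ := hsep
  -- An operator of `T` vanishing at x may itself play the role of f.
  have hle : LinearMap.range t ≤ orbit T x := by
    rintro _ ⟨y, rfl⟩
    exact (chain_mem_orbit (lt_trans (by exact_mod_cast hlt) hK) hx
      (le_reflexiveClosure T ht) htx y).1
  have := Submodule.finrank_mono hle
  have := hrank t ht ht0
  omega

lemma IsSeparatingVector.exists_add_smul {T : Submodule K (U →ₗ[K] V)}
    (hK : (finrank K T : Cardinal.{u}) < Cardinal.mk K) {x y : U}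
    (hx : IsSeparatingVector T x) (hy : ¬ IsSeparatingVector T y) :
    ∃ c : K, c ≠ 0 ∧ IsSeparatingVector T (x + c • y) := by
  let b := finBasis K T
  rw [isSeparatingVector_iff_linearIndependent b] at hx hy
  obtain ⟨c, hc, h⟩ := exists_linearIndependent_add_smul hK hx hy
  refine ⟨c, hc, (isSeparatingVector_iff_linearIndependent b).2 ?_⟩
  simpa using h

/-- The operators of a coset `g + T`, with `g ∉ T` in the reflexive closure of `T`, that vanish at
some separating vector are not all equal. -/
lemma exists_annihilators_ne {T : Submodule K (U →ₗ[K] V)}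
    (hK : (finrank K T : Cardinal.{u}) < Cardinal.mk K)
    (hsep : ∃ x, IsSeparatingVector T x)
    {g : U →ₗ[K] V} (hg : g ∈ reflexiveClosure T) (hgT : g ∉ T) :
    ∃ (x y : U) (f h : U →ₗ[K] V), IsSeparatingVector T x ∧ IsSeparatingVector T y ∧
      g - f ∈ T ∧ g - h ∈ T ∧ f x = 0 ∧ h y = 0 ∧ f ≠ h := by
  obtain ⟨x, hx⟩ := hsep
  obtain ⟨t, ht, htx⟩ := hg x
  by_contra! hcon
  have hzero : ∀ y, IsSeparatingVector T y → (g - t) y = 0 := by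
    intro y hy
    obtain ⟨s, hs, hsy⟩ := hg y
    have := hcon x y (g - t) (g - s) hx hy (by simpa using ht) (by simpa using hs)
      (by simp [htx]) (by simp [hsy])
    rw [this]
    simp [hsy]
  refine hgT ?_
  have : g - t = 0 := by
    ext y
    by_cases hy : IsSeparatingVector T y
    · exact hzero y hy
    -- Vanishing at the separating vectors x and x + cy, with c ≠ 0, forces vanishing at y.
    · obtain ⟨c, hc, hxy⟩ := hx.exists_add_smul hK hy
      have h1 := hzero _ hxy
      rw [map_add, hzero x hx, zero_add, map_smul] at h1
      exact (smul_eq_zero.1 h1).resolve_left hc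
  rw [sub_eq_zero.1 this]
  exact ht

end Generic

/-! ### Rank inequalities for images of nested subspaces. -/

section Ranks

variable {K : Type u} [Field K] {U : Type v} [AddCommGroup U] [Module K U]
  {V : Type w} [AddCommGroup V] [Module K V] [FiniteDimensional K U]

lemma finrank_map_add_finrank_le (t : U →ₗ[K] V) {A B : Submodule K U} (h : A ≤ B) :
    finrank K (B.map t) + finrank K A ≤ finrank K B + finrank K (A.map t) := by
  have hA := LinearMap.finrank_range_add_finrank_ker (t.domRestrict A)
  have hB := LinearMap.finrank_range_add_finrank_ker (t.domRestrict B)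
  rw [LinearMap.range_domRestrict] at hA hB
  have hk : finrank K (LinearMap.ker (t.domRestrict A)) ≤
      finrank K (LinearMap.ker (t.domRestrict B)) := by
    refine LinearMap.finrank_le_finrank_of_injective
      (f := (Submodule.inclusion h).restrict (p := LinearMap.ker (t.domRestrict A))
        (q := LinearMap.ker (t.domRestrict B)) (fun x hx => by simpa using hx)) ?_
    intro a b hab
    have := congrArg (fun z => ((z : LinearMap.ker (t.domRestrict B)) : B).1) hab
    exact Subtype.ext (Subtype.ext this)
  omega

lemma finrank_range_add_finrank_le (t : U →ₗ[K] V) (B : Submodule K U) :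
    finrank K (LinearMap.range t) + finrank K B ≤ finrank K U + finrank K (B.map t) := by
  have := finrank_map_add_finrank_le t (le_top : B ≤ ⊤)
  rwa [Submodule.map_top, finrank_top] at this

lemma finrank_comap_of_le_range (f : U →ₗ[K] V) {N : Submodule K V}
    (hN : N ≤ LinearMap.range f) :
    finrank K (N.comap f) = finrank K N + finrank K (LinearMap.ker f) := by
  have h := LinearMap.finrank_range_add_finrank_ker (f.domRestrict (N.comap f))
  rw [LinearMap.range_domRestrict, Submodule.map_comap_eq, inf_eq_right.2 hN] at h
  have hk : finrank K (LinearMap.ker (f.domRestrict (N.comap f))) =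
      finrank K (LinearMap.ker f) := by
    rw [LinearMap.ker_domRestrict, ← LinearEquiv.finrank_eq (Submodule.comapSubtypeEquivOfLe
      (p := LinearMap.ker f) (q := N.comap f) _)]
    intro x hx
    simp only [LinearMap.mem_ker] at hx
    simp [hx]
  omega

end Ranks

/-! ### Ranks and kernels of annihilators of separating vectors. -/

section Annihilators

variable {K : Type u} [Field K] {U : Type v} [AddCommGroup U] [Module K U]
  {V : Type w} [AddCommGroup V] [Module K V]
  [FiniteDimensional K U] [FiniteDimensional K V]
  {T : Submodule K (U →ₗ[K] V)} {x : U} {f : U →ₗ[K] V}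

lemma IsSeparatingVector.chain_mem_orbit (hx : IsSeparatingVector T x)
    (hK : (finrank K T : Cardinal.{u}) < Cardinal.mk K)
    (hf : f ∈ reflexiveClosure T) (hfx : f x = 0) (y : U) :
    f y ∈ orbit T x ∧
    (∀ t ∈ T, t x = f y → t y ∈ orbit T x) ∧
    (∀ t ∈ T, ∀ s ∈ T, t x = f y → s x = t y → s y ∈ orbit T x) :=
  OperatorSpace.chain_mem_orbit (by rwa [hx.finrank_orbit])
    (fun y => by rw [hx.finrank_orbit]; exact finrank_orbit_le T y) hf hfx y

lemma IsSeparatingVector.range_le_orbit (hx : IsSeparatingVector T x)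
    (hK : (finrank K T : Cardinal.{u}) < Cardinal.mk K)
    (hf : f ∈ reflexiveClosure T) (hfx : f x = 0) : LinearMap.range f ≤ orbit T x := by
  rintro _ ⟨y, rfl⟩
  exact (hx.chain_mem_orbit hK hf hfx y).1

/-- Polarisation: y ↦ t y, where t x = f y, is quadratic with values in T x, and t z + s y is its
polar form. -/
lemma IsSeparatingVector.add_mem_orbit (hx : IsSeparatingVector T x)
    (hK : (finrank K T : Cardinal.{u}) < Cardinal.mk K)
    (hf : f ∈ reflexiveClosure T) (hfx : f x = 0) {y z : U} {s t : U →ₗ[K] V}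
    (ht : t ∈ T) (hs : s ∈ T) (hty : t x = f y) (hsz : s x = f z) :
    t z + s y ∈ orbit T x := by
  have h := (hx.chain_mem_orbit hK hf hfx (y + z)).2.1 (t + s) (T.add_mem ht hs)
    (by simp [hty, hsz])
  have h1 := (hx.chain_mem_orbit hK hf hfx y).2.1 t ht hty
  have h2 := (hx.chain_mem_orbit hK hf hfx z).2.1 s hs hsz
  have : t z + s y = (t + s) (y + z) - t y - s z := by
    simp only [LinearMap.add_apply, map_add]
    abel
  rw [this]
  exact sub_mem (sub_mem h h1) h2

lemma IsSeparatingVector.apply_mem_iff (hx : IsSeparatingVector T x)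
    (hK : (finrank K T : Cardinal.{u}) < Cardinal.mk K)
    (hf : f ∈ reflexiveClosure T) (hfx : f x = 0) {y z : U} {s t : U →ₗ[K] V}
    (ht : t ∈ T) (hs : s ∈ T) (hty : t x = f y) (hsz : s x = f z) :
    t z ∈ orbit T x ↔ s y ∈ orbit T x := by
  have h := hx.add_mem_orbit hK hf hfx ht hs hty hsz
  exact ⟨fun h' => (Submodule.add_mem_iff_right _ h').1 h,
    fun h' => (Submodule.add_mem_iff_left _ h').1 h⟩

lemma IsSeparatingVector.apply_ker_mem_orbit (hx : IsSeparatingVector T x)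
    (hK : (finrank K T : Cardinal.{u}) < Cardinal.mk K)
    (hf : f ∈ reflexiveClosure T) (hfx : f x = 0) {y z : U} {t : U →ₗ[K] V}
    (ht : t ∈ T) (hty : t x = f y) (hz : f z = 0) : t z ∈ orbit T x := by
  simpa using hx.add_mem_orbit hK hf hfx ht T.zero_mem hty (z := z) (by simp [hz])

lemma exists_ne_zero_ne_one (hK : ((2 : ℕ) : Cardinal.{u}) < Cardinal.mk K) :
    ∃ c : K, c ≠ 0 ∧ c ≠ 1 := by
  obtain ⟨c, hc⟩ := Polynomial.exists_eval_ne_zero_of_natDegree_lt_card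
    (Polynomial.X * (Polynomial.X - Polynomial.C (1 : K)))
    (mul_ne_zero Polynomial.X_ne_zero (Polynomial.X_sub_C_ne_zero 1)) (by
      rwa [Polynomial.natDegree_mul Polynomial.X_ne_zero (Polynomial.X_sub_C_ne_zero 1),
        Polynomial.natDegree_X, Polynomial.natDegree_X_sub_C])
  simp only [Polynomial.eval_mul, Polynomial.eval_X, Polynomial.eval_sub,
    Polynomial.eval_C] at hc
  exact ⟨c, left_ne_zero_of_mul hc, sub_ne_zero.1 (right_ne_zero_of_mul hc)⟩

/-- The longest chain relation at y + cz reads s y + c(r y + s z) + c² r z ∈ T x. Removing s y and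
dividing by c, two distinct non-zero values of c separate the remaining terms. -/
lemma IsSeparatingVector.chain_ker_mem_orbit (hx : IsSeparatingVector T x)
    (hK : (finrank K T : Cardinal.{u}) < Cardinal.mk K) (h2 : 2 ≤ finrank K T)
    (hf : f ∈ reflexiveClosure T) (hfx : f x = 0) {y z : U} {t s r : U →ₗ[K] V}
    (ht : t ∈ T) (hs : s ∈ T) (hr : r ∈ T) (hty : t x = f y) (hz : f z = 0)
    (hsy : s x = t y) (hrz : r x = t z) :
    r z ∈ orbit T x ∧ r y + s z ∈ orbit T x := by
  have hc : ∀ c : K, c ≠ 0 → (r y + s z) + c • r z ∈ orbit T x := by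
    intro c hc
    have h1 := (hx.chain_mem_orbit hK hf hfx (y + c • z)).2.2 t ht (s + c • r)
      (T.add_mem hs (T.smul_mem c hr)) (by simp [hty, hz]) (by simp [hsy, hrz])
    have h0 := (hx.chain_mem_orbit hK hf hfx y).2.2 t ht s hs hty hsy
    have h3 := sub_mem h1 h0
    refine (Submodule.smul_mem_iff _ hc).1 ?_
    convert h3 using 1
    simp only [LinearMap.add_apply, map_add, LinearMap.smul_apply, map_smul]
    module
  obtain ⟨c, hc0, hc1⟩ := exists_ne_zero_ne_one (K := K)
    (lt_of_le_of_lt (by exact_mod_cast h2) hK)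
  have e1 := hc 1 one_ne_zero
  have hrz' : r z ∈ orbit T x := by
    refine (Submodule.smul_mem_iff _ (sub_ne_zero.2 hc1)).1 ?_
    convert sub_mem (hc c hc0) e1 using 1
    module
  refine ⟨hrz', ?_⟩
  rw [one_smul] at e1
  exact (Submodule.add_mem_iff_left _ hrz').1 e1

/-- An annihilator of a separating vector cannot map onto its orbit. -/
lemma IsSeparatingVector.finrank_range_ne (hx : IsSeparatingVector T x)
    (hK : (finrank K T : Cardinal.{u}) < Cardinal.mk K) (h3 : 3 ≤ finrank K T)
    (hrank : ∀ t ∈ T, t ≠ 0 → 2 * finrank K T - 2 ≤ finrank K (LinearMap.range t))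
    (hf : f ∈ reflexiveClosure T) (hfx : f x = 0) :
    finrank K (LinearMap.range f) ≠ finrank K T := by
  intro hfn
  have hrange : LinearMap.range f = orbit T x :=
    Submodule.eq_of_le_of_finrank_eq (hx.range_le_orbit hK hf hfx)
      (by rw [hfn, hx.finrank_orbit])
  have hlift : ∀ v ∈ orbit T x, ∃ y, f y = v := fun v hv => by rwa [← hrange] at hv
  have hdown : ∀ w, ∃ s ∈ T, s x = f w := fun w =>
    mem_orbit.1 (hx.chain_mem_orbit hK hf hfx w).1
  choose τ hτT hτ using hdown
  -- The relation w ∈ W y is reflexive and symmetric, and every W y contains ker f.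
  let W : U → Submodule K U := fun y => (orbit T x).comap (τ y)
  have hW : ∀ y w, w ∈ W y ↔ τ y w ∈ orbit T x := fun y w => Iff.rfl
  have hsymm : ∀ y w, w ∈ W y ↔ y ∈ W w := fun y w =>
    hx.apply_mem_iff hK hf hfx (hτT y) (hτT w) (hτ y) (hτ w)
  have hself : ∀ y, y ∈ W y := fun y =>
    (hx.chain_mem_orbit hK hf hfx y).2.1 _ (hτT y) (hτ y)
  have hkerW : ∀ y, LinearMap.ker f ≤ W y := fun y z hz =>
    hx.apply_ker_mem_orbit hK hf hfx (hτT y) (hτ y) hz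
  have hdimU := LinearMap.finrank_range_add_finrank_ker f
  -- Put ω = dim W y - dim ker f. The inclusion τ y (Y) ⊆ f (W y) and the rank bound give n - 2 + ω
  -- ≤ dim τ y (W y) ≤ min(n, 2ω - 1), whence ω = 2 and n = 3.
  have hdimW : ∀ y, f y ≠ 0 →
      finrank K T = 3 ∧ finrank K (W y) = finrank K (LinearMap.ker f) + 2 := by
    intro y hy
    have hyk : y ∉ LinearMap.ker f := hy
    have hτ0 : τ y ≠ 0 := fun h => hy (by rw [← hτ y, h, LinearMap.zero_apply])
    let Y := LinearMap.ker f ⊔ (K ∙ y)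
    have hYW : Y ≤ W y := sup_le (hkerW y) (by simpa using hself y)
    have hYdim : finrank K Y = finrank K (LinearMap.ker f) + 1 :=
      Submodule.finrank_sup_span_singleton hyk
    let N := (W y).map f
    have hNdim : finrank K (W y) = finrank K N + finrank K (LinearMap.ker f) := by
      rw [← finrank_comap_of_le_range f (N := N) LinearMap.map_le_range,
        Submodule.comap_map_eq, sup_eq_left.2 (hkerW y)]
    have hYN : Y.map (τ y) ≤ N := by
      have hmemN : ∀ r ∈ T, r y ∈ orbit T x → r x ∈ N := by
        intro r hr hry
        obtain ⟨w, hw⟩ := hlift _ (apply_mem_orbit hr x)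
        exact ⟨w, (hx.apply_mem_iff hK hf hfx (hτT y) hr (hτ y) hw.symm).2 hry, hw⟩
      obtain ⟨s, hs, hsx⟩ := mem_orbit.1 (hself y)
      rw [Submodule.map_sup, sup_le_iff, Submodule.map_span, Set.image_singleton,
        Submodule.span_singleton_le_iff_mem, ← hsx]
      refine ⟨?_, hmemN s hs
        ((hx.chain_mem_orbit hK hf hfx y).2.2 _ (hτT y) s hs (hτ y) hsx)⟩
      rintro _ ⟨z, hz, rfl⟩
      obtain ⟨r, hr, hrx⟩ := mem_orbit.1 (hkerW y hz)
      have h := (hx.chain_ker_mem_orbit hK (by omega) hf hfx (hτT y) hs hr (hτ y) hz hsx hrx).2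
      obtain ⟨w, hw⟩ := hlift _ (apply_mem_orbit hs x)
      have hsz : s z ∈ orbit T x := hx.apply_ker_mem_orbit hK hf hfx hs hw.symm hz
      rw [← hrx]
      exact hmemN r hr ((Submodule.add_mem_iff_left _ hsz).1 h)
    have h1 := finrank_map_add_finrank_le (τ y) hYW
    have h2 := finrank_range_add_finrank_le (τ y) (W y)
    have h4 := Submodule.finrank_mono hYN
    have h5 : finrank K ((W y).map (τ y)) ≤ finrank K T := by
      rw [← hx.finrank_orbit]
      exact Submodule.finrank_mono (Submodule.map_comap_le _ _)
    have h6 := hrank _ (hτT y) hτ0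
    have h7 := Submodule.finrank_mono hYW
    omega
  have hex : ∀ A : Submodule K U, finrank K A < finrank K U → ∃ r, r ∉ A := by
    intro A hA
    by_contra! h
    rw [(Submodule.eq_top_iff'.2 h : A = ⊤), finrank_top] at hA
    omega
  -- In the projective plane of U / ker f, W acts as a polarity with every point on its polar line.
  -- For r off W y, a point v ≠ y of W y ∩ W r has polar line vy = W y, so symmetry puts r on W y
  -- after all.
  obtain ⟨y, hyk⟩ := hex (LinearMap.ker f) (by omega)
  obtain ⟨hn, hWy⟩ := hdimW y hyk
  obtain ⟨r, hr⟩ := hex (W y) (by omega)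
  have hrk : f r ≠ 0 := fun h => hr (hkerW y h)
  obtain ⟨-, hWr⟩ := hdimW r hrk
  let Y := LinearMap.ker f ⊔ (K ∙ y)
  have hYW : ∀ v, y ∈ W v → Y ≤ W v := fun v hv => sup_le (hkerW v) (by simpa using hv)
  have hYdim : finrank K Y = finrank K (LinearMap.ker f) + 1 :=
    Submodule.finrank_sup_span_singleton hyk
  have hinf : ¬ W y ⊓ W r ≤ Y := by
    intro hle
    have h1 := Submodule.finrank_sup_add_finrank_inf_eq (W y) (W r)
    have h2 := Submodule.finrank_le (W y ⊔ W r)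
    have heq := Submodule.eq_of_le_of_finrank_le hle (by omega)
    have : y ∈ W y ⊓ W r := heq ▸ Submodule.mem_sup_right (Submodule.mem_span_singleton_self y)
    exact hr ((hsymm r y).1 this.2)
  obtain ⟨v, ⟨hvy, hvr⟩, hvY⟩ := SetLike.not_le_iff_exists.1 hinf
  have hvk : f v ≠ 0 := fun h => hvY (Submodule.mem_sup_left h)
  obtain ⟨-, hWv⟩ := hdimW v hvk
  have hYv : finrank K (Y ⊔ (K ∙ v) : Submodule K U) = finrank K Y + 1 :=
    Submodule.finrank_sup_span_singleton hvY
  have hle : Y ⊔ (K ∙ v) ≤ W y := sup_le (hYW y (hself y)) (by simpa using hvy)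
  have heq : Y ⊔ (K ∙ v) = W y := Submodule.eq_of_le_of_finrank_le hle (by omega)
  have hle' : W y ≤ W v := heq ▸ sup_le (hYW v ((hsymm y v).1 hvy)) (by simpa using hself v)
  have heq' : W y = W v := Submodule.eq_of_le_of_finrank_le hle' (by omega)
  exact hr (heq' ▸ (hsymm r v).1 hvr)

/-- If an annihilator `f` of a separating vector `x` has corank one in its orbit, the operators of
`T` that map `x` into the range of `f` map the kernel of `f` onto the range of `f`. -/
lemma IsSeparatingVector.map_ker_eq_range (hx : IsSeparatingVector T x)
    (hK : (finrank K T : Cardinal.{u}) < Cardinal.mk K) (h3 : 3 ≤ finrank K T)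
    (hrank : ∀ t ∈ T, t ≠ 0 → 2 * finrank K T - 2 ≤ finrank K (LinearMap.range t))
    (hf : f ∈ reflexiveClosure T) (hfx : f x = 0)
    (hfn : finrank K (LinearMap.range f) + 1 = finrank K T)
    {t : U →ₗ[K] V} (ht : t ∈ T) (ht0 : t ≠ 0) (htx : t x ∈ LinearMap.range f) :
    (LinearMap.ker f).map t = LinearMap.range f := by
  obtain ⟨y, hy⟩ := htx
  have hO := hx.finrank_orbit
  have hle := hx.range_le_orbit hK hf hfx
  have hfy : f y ≠ 0 := fun h => ht0 (hx t ht (by rw [← hy, h]))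
  have hyk : y ∉ LinearMap.ker f := hfy
  let W := (orbit T x).comap t
  have hty : t y ∈ orbit T x := (hx.chain_mem_orbit hK hf hfx y).2.1 t ht hy.symm
  have hYW : LinearMap.ker f ⊔ (K ∙ y) ≤ W := by
    refine sup_le (fun z hz => hx.apply_ker_mem_orbit hK hf hfx ht hy.symm hz) ?_
    exact (Submodule.span_singleton_le_iff_mem _ _).2 hty
  have hYdim : finrank K (LinearMap.ker f ⊔ (K ∙ y) : Submodule K U)
      = finrank K (LinearMap.ker f) + 1 := Submodule.finrank_sup_span_singleton hyk
  have hmapW : W.map t ≤ orbit T x := Submodule.map_comap_le _ _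
  have hdimU := LinearMap.finrank_range_add_finrank_ker f
  have h1 := finrank_range_add_finrank_le t W
  have h2 := Submodule.finrank_mono hmapW
  have h4 := Submodule.finrank_mono hYW
  have h5 := hrank t ht ht0
  -- The rank bound gives dim W ≤ dim ker f + 1, and equality forces t to map W onto T x.
  have hWeq : LinearMap.ker f ⊔ (K ∙ y) = W := Submodule.eq_of_le_of_finrank_le hYW (by omega)
  have hmapeq : W.map t = orbit T x := Submodule.eq_of_le_of_finrank_le hmapW (by omega)
  have hsup : (LinearMap.ker f).map t ⊔ (K ∙ t y) = orbit T x := by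
    rw [← hmapeq, ← hWeq, Submodule.map_sup, Submodule.map_span, Set.image_singleton]
  -- Here T x = range f ⊕ K (s z). With q x = s z, each r ∈ T is a multiple of q plus an operator
  -- sending x into range f; both send z into T x.
  have hcase : ∀ z, f z = 0 → (∃ s ∈ T, s x ∈ LinearMap.range f ∧ s z ∉ LinearMap.range f) →
      ∀ s ∈ T, s z ∈ orbit T x := by
    rintro z hz ⟨s, hs, ⟨w, hw⟩, hsz⟩ r hr
    have hszO : s z ∈ orbit T x := hx.apply_ker_mem_orbit hK hf hfx hs hw.symm hz
    obtain ⟨q, hq, hqx⟩ := mem_orbit.1 hszO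
    obtain ⟨p, hp, hpx⟩ := mem_orbit.1
      ((hx.chain_mem_orbit hK hf hfx w).2.1 s hs hw.symm)
    have hqz := (hx.chain_ker_mem_orbit hK (by omega) hf hfx hs hp hq hw.symm hz hpx hqx).1
    have htop : LinearMap.range f ⊔ (K ∙ s z) = orbit T x := by
      refine Submodule.eq_of_le_of_finrank_le (sup_le hle (by simpa using hszO)) ?_
      rw [Submodule.finrank_sup_span_singleton hsz, hO, hfn]
    have hrx := apply_mem_orbit hr x
    rw [← htop] at hrx
    obtain ⟨a, ⟨b, rfl⟩, c, hc, hac⟩ := Submodule.mem_sup.1 hrx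
    obtain ⟨d, rfl⟩ := Submodule.mem_span_singleton.1 hc
    have := hx.apply_ker_mem_orbit hK hf hfx (T.sub_mem hr (T.smul_mem d hq))
      (y := b) (by simp [← hac, hqx]) hz
    have h' := add_mem this (Submodule.smul_mem _ d hqz)
    simpa using h'
  by_cases hall : ∀ z, f z = 0 → ∀ s ∈ T, s x ∈ LinearMap.range f → s z ∈ LinearMap.range f
  · have hmap : (LinearMap.ker f).map t ≤ LinearMap.range f := by
      rintro _ ⟨z, hz, rfl⟩
      exact hall z hz t ht ⟨y, hy⟩
    refine Submodule.eq_of_le_of_finrank_le hmap ?_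
    have := Submodule.finrank_add_le_finrank_add_finrank ((LinearMap.ker f).map t) (K ∙ t y)
    rw [hsup] at this
    have : finrank K (K ∙ t y) ≤ 1 := (finrank_span_le_card {t y}).trans (by simp)
    omega
  -- Otherwise T z ⊆ T x for all z in ker f, then T y ⊆ T x; by symmetry W is everything, so rank f
  -- ≤ 1, against n ≥ 3.
  · exfalso
    push Not at hall
    obtain ⟨z₀, hz₀, s₀, hs₀, hs₀x, hs₀z⟩ := hall
    have hkerO : ∀ z, f z = 0 → ∀ s ∈ T, s z ∈ orbit T x := by
      intro z hz s hs
      by_cases h : s₀ z ∈ LinearMap.range f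
      -- Translating by z₀ brings z into the case already treated.
      · have h1 := hcase (z + z₀) (by simp [hz, hz₀]) ⟨s₀, hs₀, hs₀x, fun h' => hs₀z (by
          rw [map_add] at h'
          exact (Submodule.add_mem_iff_right _ h).1 h')⟩ s hs
        have h2 := hcase z₀ hz₀ ⟨s₀, hs₀, hs₀x, hs₀z⟩ s hs
        rw [map_add] at h1
        exact (Submodule.add_mem_iff_left _ h2).1 h1
      · exact hcase z hz ⟨s₀, hs₀, hs₀x, h⟩ s hs
    obtain ⟨p, hp, hpx⟩ := mem_orbit.1 hty
    have hyO : ∀ s ∈ T, s y ∈ orbit T x := by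
      intro s hs
      have hsx := apply_mem_orbit hs x
      rw [← hsup] at hsx
      obtain ⟨a, ⟨z, hz, rfl⟩, c, hc, hac⟩ := Submodule.mem_sup.1 hsx
      obtain ⟨d, rfl⟩ := Submodule.mem_span_singleton.1 hc
      have hr : s - d • p ∈ T := T.sub_mem hs (T.smul_mem d hp)
      have h1 := (hx.chain_ker_mem_orbit hK (by omega) hf hfx ht hp hr hy.symm hz hpx
        (by simp [← hac, hpx])).2
      have h2 := (Submodule.add_mem_iff_left _ (hkerO z hz p hp)).1 h1
      have h3 := (hx.chain_mem_orbit hK hf hfx y).2.2 t ht p hp hy.symm hpx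
      have h' := add_mem h2 (Submodule.smul_mem _ d h3)
      simpa using h'
    have hH : LinearMap.range f ≤ K ∙ f y := by
      rintro _ ⟨w, rfl⟩
      obtain ⟨s, hs, hsx⟩ := mem_orbit.1 (hle (LinearMap.mem_range_self f w))
      have hw : w ∈ W := (hx.apply_mem_iff hK hf hfx ht hs hy.symm hsx).2 (hyO s hs)
      rw [← hWeq] at hw
      obtain ⟨a, ha, c, hc, rfl⟩ := Submodule.mem_sup.1 hw
      obtain ⟨d, rfl⟩ := Submodule.mem_span_singleton.1 hc
      rw [map_add, LinearMap.mem_ker.1 ha, zero_add, map_smul]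
      exact Submodule.smul_mem _ _ (Submodule.mem_span_singleton_self _)
    have := Submodule.finrank_mono hH
    have := finrank_span_singleton (K := K) hfy
    omega

end Annihilators

/-! ### Reading the two products off a splitting. -/

section Assembly

variable {K : Type u} [Field K] {U : Type v} [AddCommGroup U] [Module K U]
  {V : Type w} [AddCommGroup V] [Module K V]
  [FiniteDimensional K U] [FiniteDimensional K V]

/-- An extension `T ⊕ K f` of `T` by an operator of its reflexive closure that splits as
`Q ⊕ K f ⊕ K h`, where the non-zero operators of `Q` embed `ker f` into `range f` and `ker h` into
`range h`, is a twisted operator space. -/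
lemma exists_algebra_of_splitting {d : ℕ} (hd : 0 < d) {T Q : Submodule K (U →ₗ[K] V)}
    {f h : U →ₗ[K] V} (hT : finrank K T = d + 1) (hf : f ∈ reflexiveClosure T) (hfT : f ∉ T)
    (hfh : f - h ∈ T) (hQS : Q ≤ T ⊔ (K ∙ f))
    (hS : ∀ s ∈ T ⊔ (K ∙ f), ∃ q ∈ Q, ∃ a b : K, s = q + a • f + b • h)
    (hQ : finrank K Q = d) (hkf : finrank K (LinearMap.ker f) = d)
    (hkh : finrank K (LinearMap.ker h) = d) (hU : finrank K U = d + d)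
    (hV : finrank K V = d + d) (hker : Disjoint (LinearMap.ker f) (LinearMap.ker h))
    (hran : Disjoint (LinearMap.range f) (LinearMap.range h))
    (hQf : ∀ q ∈ Q, ∀ z, f z = 0 → q z ∈ LinearMap.range f ∧ (q ≠ 0 → q z = 0 → z = 0))
    (hQh : ∀ q ∈ Q, ∀ z, h z = 0 → q z ∈ LinearMap.range h ∧ (q ≠ 0 → q z = 0 → z = 0)) :
    ∃ (A : Type u) (_ : AddCommGroup A) (_ : Module K A) (star bullet : A →ₗ[K] A →ₗ[K] A),
      IsLDBDivisionAlgebra star bullet ∧ finrank K A = d ∧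
      ∃ H : Submodule K ((A × A) →ₗ[K] (A × A)),
        IsHyperplaneOf H (twistedOperatorSpace star bullet) ∧ Equivalent T H := by
  obtain ⟨A, _, _, _, hAdim⟩ : ∃ (A : Type u) (_ : AddCommGroup A) (_ : Module K A),
      FiniteDimensional K A ∧ finrank K A = d :=
    ⟨Fin d → K, inferInstance, inferInstance, inferInstance, by simp⟩
  have hAA : finrank K (A × A) = d + d := by rw [finrank_prod, hAdim]
  let eQ : A ≃ₗ[K] Q := LinearEquiv.ofFinrankEq _ _ (by rw [hAdim, hQ])
  let e₁ : A ≃ₗ[K] LinearMap.ker h := LinearEquiv.ofFinrankEq _ _ (by rw [hAdim, hkh])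
  let e₂ : A ≃ₗ[K] LinearMap.ker f := LinearEquiv.ofFinrankEq _ _ (by rw [hAdim, hkf])
  have he₁ : ∀ y, h (e₁ y) = 0 := fun y => (e₁ y).2
  have he₂ : ∀ z, f (e₂ z) = 0 := fun z => (e₂ z).2
  have hboth : ∀ w, f w = 0 → h w = 0 → w = 0 := fun w h1 h2 =>
    Submodule.disjoint_def.1 hker w h1 h2
  let F₀ : A × A →ₗ[K] U :=
    ((LinearMap.ker h).subtype ∘ₗ e₁.toLinearMap).coprod
      ((LinearMap.ker f).subtype ∘ₗ e₂.toLinearMap)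
  have hF₀ : ∀ p, F₀ p = e₁ p.1 + e₂ p.2 := fun p => rfl
  have hF₀inj : Function.Injective F₀ := by
    rw [← LinearMap.ker_eq_bot, LinearMap.ker_eq_bot']
    rintro ⟨y, z⟩ hp
    rw [hF₀] at hp
    have h1 : f (e₁ y) = 0 := by simpa [he₂] using congrArg f hp
    have h2 : h (e₂ z) = 0 := by simpa [he₁] using congrArg h hp
    have h3 : y = 0 := by simpa using hboth _ h1 (he₁ y)
    have h4 : z = 0 := by simpa using hboth _ (he₂ z) h2
    rw [h3, h4]
    rfl
  -- The target coordinates are chosen so that f and h become (y, z) ↦ (y, 0) and (y, z) ↦ (0, z).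
  let G₀ : A × A →ₗ[K] V :=
    (f ∘ₗ (LinearMap.ker h).subtype ∘ₗ e₁.toLinearMap).coprod
      (h ∘ₗ (LinearMap.ker f).subtype ∘ₗ e₂.toLinearMap)
  have hG₀ : ∀ p, G₀ p = f (e₁ p.1) + h (e₂ p.2) := fun p => rfl
  have hG₀inj : Function.Injective G₀ := by
    rw [← LinearMap.ker_eq_bot, LinearMap.ker_eq_bot']
    rintro ⟨y, z⟩ hp
    rw [hG₀] at hp
    have h0 : f (e₁ y) = 0 := by
      refine Submodule.disjoint_def.1 hran _ (LinearMap.mem_range_self _ _) ?_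
      rw [eq_neg_of_add_eq_zero_left hp]
      exact neg_mem (LinearMap.mem_range_self _ _)
    simp only at hp
    rw [h0, zero_add] at hp
    have h3 : y = 0 := by simpa using hboth _ h0 (he₁ y)
    have h4 : z = 0 := by simpa using hboth _ (he₂ z) hp
    rw [h3, h4]
    rfl
  let F : (A × A) ≃ₗ[K] U := F₀.linearEquivOfInjective hF₀inj (by rw [hAA, hU])
  let G : (A × A) ≃ₗ[K] V := G₀.linearEquivOfInjective hG₀inj (by rw [hAA, hV])
  have hF : ∀ p, F p = e₁ p.1 + e₂ p.2 := fun p => rfl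
  have hG : ∀ p, G p = f (e₁ p.1) + h (e₂ p.2) := fun p => rfl
  let Ψ : (U →ₗ[K] V) ≃ₗ[K] ((A × A) →ₗ[K] (A × A)) := LinearEquiv.arrowCongr F.symm G.symm
  have hΨ : ∀ s p, Ψ s p = G.symm (s (F p)) := fun s p => by
    simp [Ψ, LinearEquiv.arrowCongr_apply]
  have hΨf : ∀ p, Ψ f p = (p.1, 0) := fun p => by
    rw [hΨ, LinearEquiv.symm_apply_eq, hF, hG]
    simp [he₂]
  have hΨh : ∀ p, Ψ h p = (0, p.2) := fun p => by
    rw [hΨ, LinearEquiv.symm_apply_eq, hF, hG]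
    simp [he₁]
  let ψ : A →ₗ[K] ((A × A) →ₗ[K] (A × A)) := Ψ.toLinearMap ∘ₗ Q.subtype ∘ₗ eQ.toLinearMap
  have hψ : ∀ a p, ψ a p = G.symm ((eQ a : U →ₗ[K] V) (F p)) := fun a p => hΨ _ p
  have hψr : ∀ a z, (ψ a (0, z)).2 = 0 := by
    intro a z
    obtain ⟨w, hw⟩ := (hQf _ (eQ a).2 _ (he₂ z)).1
    obtain ⟨p, rfl⟩ := F.surjective w
    have : ψ a (0, z) = (p.1, 0) := by
      rw [hψ, LinearEquiv.symm_apply_eq, hG, hF]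
      simp only [map_zero, ZeroMemClass.coe_zero, zero_add, add_zero]
      rw [← hw, hF, map_add, he₂, add_zero]
    rw [this]
  have hψl : ∀ a y, (ψ a (y, 0)).1 = 0 := by
    intro a y
    obtain ⟨w, hw⟩ := (hQh _ (eQ a).2 _ (he₁ y)).1
    obtain ⟨p, rfl⟩ := F.surjective w
    have : ψ a (y, 0) = (0, p.2) := by
      rw [hψ, LinearEquiv.symm_apply_eq, hG, hF]
      simp only [map_zero, ZeroMemClass.coe_zero, zero_add, add_zero]
      rw [← hw, hF, map_add, he₁, zero_add]
    rw [this]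
  let star : A →ₗ[K] A →ₗ[K] A :=
    (LinearMap.fst K A A).compRight K ∘ₗ LinearMap.lcomp K (A × A) (LinearMap.inr K A A) ∘ₗ ψ
  let bullet : A →ₗ[K] A →ₗ[K] A :=
    (LinearMap.snd K A A).compRight K ∘ₗ LinearMap.lcomp K (A × A) (LinearMap.inl K A A) ∘ₗ ψ
  have hstar : ∀ a z, star a z = (ψ a (0, z)).1 := fun a z => rfl
  have hbullet : ∀ a y, bullet a y = (ψ a (y, 0)).2 := fun a y => rfl
  have hψeq : ∀ a p, ψ a p = (star a p.2, bullet a p.1) := by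
    rintro a ⟨y, z⟩
    have : ((y, z) : A × A) = (y, 0) + (0, z) := by simp
    rw [this, map_add]
    ext1
    · simp [hstar, hψl]
    · simp [hbullet, hψr]
  have htw : ∀ a b c, twistedMap star bullet (a, b, c) = Ψ (eQ a + b • f + c • h) := by
    intro a b c
    refine LinearMap.ext fun p => ?_
    rw [map_add, map_add, map_smul, map_smul, LinearMap.add_apply, LinearMap.add_apply,
      LinearMap.smul_apply, LinearMap.smul_apply, hΨf, hΨh, show Ψ (eQ a) = ψ a from rfl, hψeq]
    simp [twistedMap]
  have hhS : h ∈ T ⊔ (K ∙ f) := by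
    have h1 : f ∈ T ⊔ (K ∙ f) := Submodule.mem_sup_right (Submodule.mem_span_singleton_self f)
    have h2 := sub_mem h1 (Submodule.mem_sup_left hfh)
    rwa [sub_sub_cancel] at h2
  have htwS : twistedOperatorSpace star bullet = (T ⊔ (K ∙ f)).map Ψ.toLinearMap := by
    apply le_antisymm
    · rintro _ ⟨⟨a, b, c⟩, rfl⟩
      refine ⟨_, ?_, (htw a b c).symm⟩
      exact add_mem (add_mem (hQS (eQ a).2) (Submodule.smul_mem _ _
        (Submodule.mem_sup_right (Submodule.mem_span_singleton_self f))))
        (Submodule.smul_mem _ _ hhS)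
    · rintro _ ⟨s, hs, rfl⟩
      obtain ⟨q, hq, b, c, rfl⟩ := hS s hs
      refine ⟨(eQ.symm ⟨q, hq⟩, b, c), ?_⟩
      rw [htw]
      simp
  have hregS : ∀ a z, a ≠ 0 → star a z = 0 → z = 0 := by
    intro a z ha hz
    have h1 : ψ a (0, z) = 0 := by
      rw [hψeq]
      simp [hz]
    rw [hψ, LinearEquiv.map_eq_zero_iff, hF] at h1
    simp only [map_zero, ZeroMemClass.coe_zero, zero_add] at h1
    simpa using (hQf _ (eQ a).2 _ (he₂ z)).2 (by simpa using ha) h1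
  have hregB : ∀ a y, a ≠ 0 → bullet a y = 0 → y = 0 := by
    intro a y ha hy
    have h1 : ψ a (y, 0) = 0 := by
      rw [hψeq]
      simp [hy]
    rw [hψ, LinearEquiv.map_eq_zero_iff, hF] at h1
    simp only [map_zero, ZeroMemClass.coe_zero, add_zero] at h1
    simpa using (hQh _ (eQ a).2 _ (he₁ y)).2 (by simpa using ha) h1
  refine ⟨A, inferInstance, inferInstance, star, bullet, ⟨inferInstance, ?_, ?_, ?_, ?_⟩, hAdim,
    T.map Ψ.toLinearMap, ⟨?_, ?_⟩, F.symm, G, ?_⟩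
  · exact Module.nontrivial_of_finrank_pos (R := K) (by rw [hAdim]; exact hd)
  · exact fun a b ha hb hab => hb (hregS a b ha hab)
  · intro a y
    constructor
    · intro hay
      by_cases ha : a = 0
      · exact Or.inl ha
      · exact Or.inr (hregB a y ha hay)
    · rintro (rfl | rfl) <;> simp
  · intro a y hind
    have hy : y ≠ 0 := by simpa using hind.ne_zero 1
    have ha : a ≠ 0 := by
      rintro rfl
      simpa using hind.ne_zero 0
    have hz : bullet a y ≠ 0 := fun hz => hy (hregB a y ha hz)
    simp only at hind
    set z := bullet a y with hzdef
    -- Reflexive closure at the vector (y, a • y): a non-zero operator f - t vanishes there.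
    obtain ⟨t, ht, htu⟩ := hf (F (y, z))
    obtain ⟨q, hq, b, c, hs⟩ := hS (f - t) (sub_mem
      (Submodule.mem_sup_right (Submodule.mem_span_singleton_self f)) (Submodule.mem_sup_left ht))
    obtain ⟨a', ha'⟩ := eQ.surjective ⟨q, hq⟩
    have hq' : (eQ a' : U →ₗ[K] V) = q := by rw [ha']
    have h0 : twistedMap star bullet (a', b, c) (y, z) = 0 := by
      rw [htw, hq', ← hs, hΨ, LinearMap.sub_apply, htu, sub_self, map_zero]
    have h1 : star a' z + b • y = 0 := congrArg Prod.fst h0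
    have h2 : bullet a' y + c • z = 0 := congrArg Prod.snd h0
    have ha'0 : a' ≠ 0 := by
      rintro rfl
      have hb : b = 0 := by simpa [hy] using h1
      have hc : c = 0 := by simpa [hz] using h2
      rw [← hq', hb, hc] at hs
      simp only [map_zero, ZeroMemClass.coe_zero, zero_smul, add_zero] at hs
      exact hfT (sub_eq_zero.1 hs ▸ ht)
    -- Regularity of • gives a' = -ca, and the first coordinate becomes the required dependence,
    -- with c ≠ 0.
    have h3 : a' + c • a = 0 := by
      by_contra hne
      exact hy (hregB _ y hne (by simpa using h2))
    have hc : c ≠ 0 := by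
      rintro rfl
      exact ha'0 (by simpa using h3)
    rw [eq_neg_of_add_eq_zero_left h3] at h1
    have := (LinearIndependent.pair_iff.1 hind (-c) b (by simpa using h1)).1
    exact hc (by simpa using this)
  · rw [htwS]
    exact Submodule.map_mono le_sup_left
  · have h1 := Submodule.finrank_quotient_add_finrank (R := K)
      (M := twistedOperatorSpace star bullet)
      ((T.map Ψ.toLinearMap).submoduleOf (twistedOperatorSpace star bullet))
    have h2 : finrank K ((T.map Ψ.toLinearMap).submoduleOf (twistedOperatorSpace star bullet))
        = d + 1 := by
      rw [(Submodule.submoduleOfEquivOfLe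
        (by rw [htwS]; exact Submodule.map_mono le_sup_left)).finrank_eq,
        LinearEquiv.finrank_map_eq Ψ T, hT]
    have h3 : finrank K (twistedOperatorSpace star bullet) = d + 1 + 1 := by
      rw [htwS, LinearEquiv.finrank_map_eq Ψ (T ⊔ (K ∙ f)),
        Submodule.finrank_sup_span_singleton hfT, hT]
    omega
  · intro s
    have hback : ∀ s : U →ₗ[K] V, s = G.toLinearMap ∘ₗ Ψ s ∘ₗ F.symm.toLinearMap := by
      intro s
      ext w
      simp [hΨ]
    constructor
    · intro hs
      exact ⟨Ψ s, ⟨s, hs, rfl⟩, hback s⟩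
    · rintro ⟨_, ⟨r, hr, rfl⟩, rfl⟩
      have := hback r
      simp only [LinearEquiv.coe_coe] at this ⊢
      rwa [← this]

end Assembly

/-! ### Operators sending x into the range of its annihilator. -/

section Splitting

variable {K : Type u} [Field K] {U : Type v} [AddCommGroup U] [Module K U]
  {V : Type w} [AddCommGroup V] [Module K V]
  [FiniteDimensional K U] [FiniteDimensional K V]
  {T : Submodule K (U →ₗ[K] V)} {x : U} {f : U →ₗ[K] V}

/-- The operators of `S` that map `x` into the range of `f`. -/
def mapsIntoRange (S : Submodule K (U →ₗ[K] V)) (x : U) (f : U →ₗ[K] V) : Submodule K S :=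
  (LinearMap.range f).comap ((LinearMap.applyₗ x).domRestrict S)

omit [FiniteDimensional K U] [FiniteDimensional K V] in
lemma mem_mapsIntoRange {S : Submodule K (U →ₗ[K] V)} {s : S} :
    s ∈ mapsIntoRange S x f ↔ (s : U →ₗ[K] V) x ∈ LinearMap.range f :=
  Iff.rfl

/-- The extra dimension is f itself, which lies in the kernel of evaluation at x. -/
lemma le_finrank_mapsIntoRange {S : Submodule K (U →ₗ[K] V)} (hfS : f ∈ S) (hf0 : f ≠ 0)
    (hfx : f x = 0) (hle : LinearMap.range f ≤ orbit S x) :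
    finrank K (LinearMap.range f) + 1 ≤ finrank K (mapsIntoRange S x f) := by
  rw [mapsIntoRange, finrank_comap_of_le_range _ (by rwa [LinearMap.range_domRestrict])]
  have : 1 ≤ finrank K (LinearMap.ker ((LinearMap.applyₗ x).domRestrict S)) := by
    refine Submodule.one_le_finrank_iff.2 ((Submodule.ne_bot_iff _).2 ⟨⟨f, hfS⟩, ?_, ?_⟩)
    · simpa using hfx
    · exact fun h => hf0 (congrArg Subtype.val h)
  omega

/-- Adding a multiple of f changes an operator neither at x nor on ker f. -/
lemma IsSeparatingVector.map_ker_eq_range_of_mem_sup (hx : IsSeparatingVector T x)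
    (hK : (finrank K T : Cardinal.{u}) < Cardinal.mk K) (h3 : 3 ≤ finrank K T)
    (hrank : ∀ t ∈ T, t ≠ 0 → 2 * finrank K T - 2 ≤ finrank K (LinearMap.range t))
    (hf : f ∈ reflexiveClosure T) (hfx : f x = 0)
    (hfn : finrank K (LinearMap.range f) + 1 = finrank K T)
    {s : U →ₗ[K] V} (hs : s ∈ T ⊔ (K ∙ f)) (hsf : s ∉ K ∙ f) (hsx : s x ∈ LinearMap.range f) :
    (LinearMap.ker f).map s = LinearMap.range f := by
  obtain ⟨t, ht, r, hr, rfl⟩ := Submodule.mem_sup.1 hs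
  obtain ⟨c, rfl⟩ := Submodule.mem_span_singleton.1 hr
  have ht0 : t ≠ 0 := by
    rintro rfl
    exact hsf (by simpa using hr)
  rw [← hx.map_ker_eq_range hK h3 hrank hf hfx hfn ht ht0 (by simpa [hfx] using hsx)]
  ext v
  simp only [Submodule.mem_map]
  refine exists_congr fun z => and_congr_right fun hz => ?_
  simp [LinearMap.mem_ker.1 hz]

omit [FiniteDimensional K V] in
lemma eq_zero_of_map_ker_eq_range {s : U →ₗ[K] V}
    (h : (LinearMap.ker f).map s = LinearMap.range f)
    (hdim : finrank K (LinearMap.ker f) = finrank K (LinearMap.range f))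
    {z : U} (hz : f z = 0) (hsz : s z = 0) : z = 0 := by
  have h1 := LinearMap.finrank_range_add_finrank_ker (s.domRestrict (LinearMap.ker f))
  rw [LinearMap.range_domRestrict, h] at h1
  have h2 : finrank K (LinearMap.ker (s.domRestrict (LinearMap.ker f))) = 0 := by omega
  have h4 : (⟨z, hz⟩ : LinearMap.ker f) ∈ LinearMap.ker (s.domRestrict (LinearMap.ker f)) := by
    simpa using hsz
  rw [Submodule.finrank_eq_zero.1 h2] at h4
  exact congrArg Subtype.val ((Submodule.mem_bot K).1 h4)

end Splitting

end OperatorSpace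

/-! ### The classification. -/

open OperatorSpace Module in
theorem corollary6p3
    {K : Type u} [Field K]
    {U : Type v} [AddCommGroup U] [Module K U] [FiniteDimensional K U]
    {V : Type w} [AddCommGroup V] [Module K V] [FiniteDimensional K V]
    (n : ℕ) (hn : 3 ≤ n) (hK : (n : Cardinal.{u}) < Cardinal.mk K)
    (T : Submodule K (U →ₗ[K] V))
    (hdim : Module.finrank K T = n)
    (hred : OperatorSpace.IsReduced T)
    (hnonrefl : ¬ OperatorSpace.IsReflexive T)
    (hrank : ∀ f ∈ T, f ≠ 0 → 2 * n - 2 ≤ Module.finrank K (LinearMap.range f)) :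
    ∃ (A : Type u) (_ : AddCommGroup A) (_ : Module K A) (star bullet : A →ₗ[K] A →ₗ[K] A),
      OperatorSpace.IsLDBDivisionAlgebra star bullet ∧
      Module.finrank K A = n - 1 ∧
      ∃ H : Submodule K ((A × A) →ₗ[K] (A × A)),
        OperatorSpace.IsHyperplaneOf H (OperatorSpace.twistedOperatorSpace star bullet) ∧
        OperatorSpace.Equivalent T H := by
  subst hdim
  obtain ⟨g, hg, hgT⟩ : ∃ g ∈ reflexiveClosure T, g ∉ T := by
    by_contra! h
    exact hnonrefl (le_antisymm (le_reflexiveClosure T) h)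
  obtain ⟨x, y, f, h, hx, hy, hgf, hgh, hfx, hhy, hne⟩ := exists_annihilators_ne hK
    (exists_isSeparatingVector hK fun f hf hf0 => by have := hrank f hf hf0; omega) hg hgT
  have hf : f ∈ reflexiveClosure T := by
    simpa using sub_mem hg (le_reflexiveClosure T hgf)
  have hh : h ∈ reflexiveClosure T := by
    simpa using sub_mem hg (le_reflexiveClosure T hgh)
  have hfT : f ∉ T := fun hfT => hgT (by simpa using add_mem hgf hfT)
  have hhT : h ∉ T := fun hhT => hgT (by simpa using add_mem hgh hhT)
  have hfh : f - h ∈ T := by simpa using sub_mem hgh hgf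
  have hfh0 : f - h ≠ 0 := sub_ne_zero.2 hne
  have hf0 : f ≠ 0 := fun h0 => hfT (h0 ▸ T.zero_mem)
  have hh0 : h ≠ 0 := fun h0 => hhT (h0 ▸ T.zero_mem)
  have hfle := hx.range_le_orbit hK hf hfx
  have hhle := hy.range_le_orbit hK hh hhy
  have hfran : finrank K (LinearMap.range f) < finrank K T :=
    lt_of_le_of_ne (hx.finrank_orbit ▸ Submodule.finrank_mono hfle)
      (hx.finrank_range_ne hK hn hrank hf hfx)
  have hhran : finrank K (LinearMap.range h) < finrank K T :=
    lt_of_le_of_ne (hy.finrank_orbit ▸ Submodule.finrank_mono hhle)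
      (hy.finrank_range_ne hK hn hrank hh hhy)
  have hsub : LinearMap.range (f - h) ≤ LinearMap.range f ⊔ LinearMap.range h := by
    rintro _ ⟨z, rfl⟩
    exact sub_mem (Submodule.mem_sup_left ⟨z, rfl⟩) (Submodule.mem_sup_right ⟨z, rfl⟩)
  have e1 := Submodule.finrank_mono hsub
  have e2 := Submodule.finrank_sup_add_finrank_inf_eq (LinearMap.range f) (LinearMap.range h)
  have e3 := hrank _ hfh hfh0
  -- 2n - 2 ≤ rank (f - h) ≤ rank f + rank h ≤ 2n - 2, so equality holds throughout.
  have hfn : finrank K (LinearMap.range f) + 1 = finrank K T := by omega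
  have hhn : finrank K (LinearMap.range h) + 1 = finrank K T := by omega
  have hran : Disjoint (LinearMap.range f) (LinearMap.range h) :=
    disjoint_iff.2 (Submodule.finrank_eq_zero.1 (by omega))
  have hhx : h x ≠ 0 := fun h0 => hfh0 (hx _ hfh (by simp [hfx, h0]))
  have hfy : f y ≠ 0 := fun h0 => hfh0 (hy _ hfh (by simp [hhy, h0]))
  have hsup : T ⊔ (K ∙ h) = T ⊔ (K ∙ f) := by
    apply le_antisymm <;> refine sup_le le_sup_left
      ((Submodule.span_singleton_le_iff_mem _ _).2 ?_)
    · rw [← sub_sub_cancel f h]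
      exact sub_mem (Submodule.mem_sup_right (Submodule.mem_span_singleton_self f))
        (Submodule.mem_sup_left hfh)
    · rw [← sub_add_cancel f h]
      exact add_mem (Submodule.mem_sup_left hfh)
        (Submodule.mem_sup_right (Submodule.mem_span_singleton_self h))
  set S := T ⊔ (K ∙ f) with hSdef
  have hfS : f ∈ S := Submodule.mem_sup_right (Submodule.mem_span_singleton_self f)
  have hhS : h ∈ S := hsup ▸ Submodule.mem_sup_right (Submodule.mem_span_singleton_self h)
  have hSdim : finrank K S = finrank K T + 1 := Submodule.finrank_sup_span_singleton hfT
  have horb : ∀ z, orbit T z ≤ orbit S z := fun z => Submodule.map_mono le_sup_left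
  let Q : Submodule K S := mapsIntoRange S x f ⊓ mapsIntoRange S y h
  -- Q is the intersection of two subspaces of dimension at least n in S, of dimension n + 1.
  have hQdim : finrank K T ≤ finrank K Q + 1 := by
    have h1 := le_finrank_mapsIntoRange hfS hf0 hfx (hfle.trans (horb x))
    have h2 := le_finrank_mapsIntoRange hhS hh0 hhy (hhle.trans (horb y))
    have h4 := Submodule.finrank_sup_add_finrank_inf_eq
      (mapsIntoRange S x f) (mapsIntoRange S y h)
    have h5 := Submodule.finrank_le (mapsIntoRange S x f ⊔ mapsIntoRange S y h)
    change _ + finrank K Q = _ at h4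
    omega
  -- At x only b h x survives, at y only a f y; each lies in both ranges, hence is zero.
  have hcomb : ∀ s : S, s ∈ Q → ∀ a b : K, (s : U →ₗ[K] V) = a • f + b • h → a = 0 ∧ b = 0 := by
    intro s hs a b hab
    have h1 := mem_mapsIntoRange.1 hs.1
    have h2 := mem_mapsIntoRange.1 hs.2
    rw [hab] at h1 h2
    simp only [LinearMap.add_apply, LinearMap.smul_apply, hfx, hhy, smul_zero, zero_add,
      add_zero] at h1 h2
    have h4 := Submodule.disjoint_def.1 hran _ h1
      (Submodule.smul_mem _ b (LinearMap.mem_range_self h x))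
    have h5 := Submodule.disjoint_def.1 hran _
      (Submodule.smul_mem _ a (LinearMap.mem_range_self f y)) h2
    exact ⟨(smul_eq_zero.1 h5).resolve_right hfy, (smul_eq_zero.1 h4).resolve_right hhx⟩
  have hfQ : (⟨f, hfS⟩ : S) ∉ Q := fun hQ =>
    one_ne_zero (hcomb _ hQ 1 0 (by simp)).1
  have hhQ : (⟨h, hhS⟩ : S) ∉ Q ⊔ (K ∙ (⟨f, hfS⟩ : S)) := by
    intro hmem
    obtain ⟨q, hq, r, hr, hqr⟩ := Submodule.mem_sup.1 hmem
    obtain ⟨c, rfl⟩ := Submodule.mem_span_singleton.1 hr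
    have := congrArg Subtype.val (eq_sub_of_add_eq hqr)
    exact one_ne_zero (hcomb q hq (-c) 1 (by rw [this]; simp; abel)).2
  have hd1 := Submodule.finrank_sup_span_singleton hfQ
  have hd2 := Submodule.finrank_sup_span_singleton hhQ
  have hd3 := Submodule.finrank_le
    ((Q ⊔ (K ∙ (⟨f, hfS⟩ : S))) ⊔ (K ∙ (⟨h, hhS⟩ : S)))
  have htop : (Q ⊔ (K ∙ (⟨f, hfS⟩ : S))) ⊔ (K ∙ (⟨h, hhS⟩ : S)) = ⊤ :=
    Submodule.eq_top_of_finrank_eq (by omega)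
  have hdecomp : ∀ s ∈ S, ∃ q ∈ Q.map S.subtype, ∃ a b : K, s = q + a • f + b • h := by
    intro s hs
    have hmem : (⟨s, hs⟩ : S) ∈ (Q ⊔ (K ∙ (⟨f, hfS⟩ : S))) ⊔ (K ∙ (⟨h, hhS⟩ : S)) :=
      htop ▸ Submodule.mem_top
    obtain ⟨p, hp, r, hr, hpr⟩ := Submodule.mem_sup.1 hmem
    obtain ⟨b, rfl⟩ := Submodule.mem_span_singleton.1 hr
    obtain ⟨q, hq, r, hr, rfl⟩ := Submodule.mem_sup.1 hp
    obtain ⟨a, rfl⟩ := Submodule.mem_span_singleton.1 hr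
    exact ⟨q, ⟨q, hq, rfl⟩, a, b, (congrArg Subtype.val hpr).symm⟩
  have hQf : ∀ q : S, q ∈ Q → q ≠ 0 →
      (LinearMap.ker f).map (q : U →ₗ[K] V) = LinearMap.range f := by
    intro q hq hq0
    refine hx.map_ker_eq_range_of_mem_sup hK hn hrank hf hfx hfn q.2 (fun hqf => hq0 ?_)
      (mem_mapsIntoRange.1 hq.1)
    obtain ⟨c, hc⟩ := Submodule.mem_span_singleton.1 hqf
    have := (hcomb q hq c 0 (by simp [hc])).1
    exact Subtype.ext (by rw [← hc, this]; simp)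
  have hQh : ∀ q : S, q ∈ Q → q ≠ 0 →
      (LinearMap.ker h).map (q : U →ₗ[K] V) = LinearMap.range h := by
    intro q hq hq0
    refine hy.map_ker_eq_range_of_mem_sup hK hn hrank hh hhy hhn (hsup.symm ▸ q.2)
      (fun hqh => hq0 ?_) (mem_mapsIntoRange.1 hq.2)
    obtain ⟨c, hc⟩ := Submodule.mem_span_singleton.1 hqh
    have := (hcomb q hq 0 c (by simp [hc])).2
    exact Subtype.ext (by rw [← hc, this]; simp)
  have hQf' : ∀ q : S, q ∈ Q → ∀ z, f z = 0 → (q : U →ₗ[K] V) z ∈ LinearMap.range f := by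
    intro q hq z hz
    by_cases hq0 : q = 0
    · simp [hq0]
    · exact hQf q hq hq0 ▸ ⟨z, hz, rfl⟩
  have hQh' : ∀ q : S, q ∈ Q → ∀ z, h z = 0 → (q : U →ₗ[K] V) z ∈ LinearMap.range h := by
    intro q hq z hz
    by_cases hq0 : q = 0
    · simp [hq0]
    · exact hQh q hq hq0 ▸ ⟨z, hz, rfl⟩
  have hker : Disjoint (LinearMap.ker f) (LinearMap.ker h) := by
    rw [Submodule.disjoint_def]
    intro z hzf hzh
    -- Q maps a common kernel vector into range f ∩ range h = 0, so all of `T` vanishes there.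
    have : z ∈ kernel T := by
      simp only [kernel, Submodule.mem_iInf]
      intro t ht
      obtain ⟨_, ⟨q, hq, rfl⟩, a, b, rfl⟩ := hdecomp t (Submodule.mem_sup_left ht)
      have hq0 := Submodule.disjoint_def.1 hran _ (hQf' q hq z hzf) (hQh' q hq z hzh)
      have hzf' : f z = 0 := hzf
      have hzh' : h z = 0 := hzh
      simp [hq0, hzf', hzh']
    rw [hred.1] at this
    simpa using this
  have k1 := LinearMap.finrank_range_add_finrank_ker f
  have k2 := LinearMap.finrank_range_add_finrank_ker h
  have k3 := LinearMap.finrank_range_add_finrank_ker (f - h)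
  have k4 := Submodule.finrank_sup_add_finrank_inf_eq (LinearMap.ker f) (LinearMap.ker h)
  rw [disjoint_iff.1 hker, finrank_bot] at k4
  have k5 := Submodule.finrank_le (LinearMap.ker f ⊔ LinearMap.ker h)
  -- Since 2n - 2 ≤ rank (f - h) ≤ dim U, both kernels have dimension at least n - 1; being
  -- disjoint, they fill U.
  have hkertop : LinearMap.ker f ⊔ LinearMap.ker h = ⊤ :=
    Submodule.eq_top_of_finrank_eq (by omega)
  have hrantop : LinearMap.range f ⊔ LinearMap.range h = ⊤ := by
    rw [eq_top_iff, ← hred.2, essentialRange, iSup₂_le_iff]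
    rintro t ht _ ⟨w, rfl⟩
    obtain ⟨_, ⟨q, hq, rfl⟩, a, b, rfl⟩ := hdecomp t (Submodule.mem_sup_left ht)
    have hw : w ∈ LinearMap.ker f ⊔ LinearMap.ker h := hkertop ▸ Submodule.mem_top
    obtain ⟨z, hz, z', hz', hzz⟩ := Submodule.mem_sup.1 hw
    have hqw : (q : U →ₗ[K] V) w ∈ LinearMap.range f ⊔ LinearMap.range h := by
      rw [← hzz, map_add]
      exact add_mem (Submodule.mem_sup_left (hQf' q hq z hz))
        (Submodule.mem_sup_right (hQh' q hq z' hz'))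
    exact add_mem (add_mem hqw (Submodule.smul_mem _ a (Submodule.mem_sup_left ⟨w, rfl⟩)))
      (Submodule.smul_mem _ b (Submodule.mem_sup_right ⟨w, rfl⟩))
  have hVdim : finrank K V = finrank K (LinearMap.range f) + finrank K (LinearMap.range h) := by
    rw [← e2, hrantop, disjoint_iff.1 hran, finrank_top, finrank_bot, add_zero]
  refine exists_algebra_of_splitting (d := finrank K T - 1) (Q := Q.map S.subtype) (f := f)
    (h := h) (by omega) (by omega) hf hfT hfh (Submodule.map_subtype_le S Q) hdecomp ?_ (by omega)
    (by omega) (by omega) (by omega) hker hran ?_ ?_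
  · rw [Submodule.finrank_map_subtype_eq]
    omega
  · rintro _ ⟨q, hq, rfl⟩ z hz
    refine ⟨hQf' q hq z hz, fun hq0 hqz => ?_⟩
    exact eq_zero_of_map_ker_eq_range (hQf q hq fun h0 => hq0 (by simp [h0])) (by omega) hz hqz
  · rintro _ ⟨q, hq, rfl⟩ z hz
    refine ⟨hQh' q hq z hz, fun hq0 hqz => ?_⟩
    exact eq_zero_of_map_ker_eq_range (hQh q hq fun h0 => hq0 (by simp [h0])) (by omega) hz hqz
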